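/- For $n\ge 1$ let $\mathcal H_n=\mathbb C^n$ with its standard inner product. Let $m,n$ be integers with $\min\{m,n\}\ge 2$. A pure state is a unit vector of $\mathcal H_m\otimes\mathcal H_n$. The Schmidt rank $SR(v)$ of $v\in\mathcal H_m\otimes\mathcal H_n$ is the rank of the operator $A_v:\mathcal H_n\to\mathcal H_m$, where $v\mapsto A_v$ is the linear map with $A_{a\otimes b}\,x=\big(\sum_j b_jx_j\big)a$; for a pure state it equals the number of non-zero terms in a Schmidt decomposition of $v$. For $1\le k\le\min\{m,n\}$ let $$\mathcal S_k:=\{c\,w : c\in\mathbb R,\ w\in\mathcal H_m\otimes\mathcal H_n,\ \|w\|=1,\ SR(w)\le k\}.$$ When $m=n$, let $S$ be the swap operator, $S(a\otimes b)=b\otimes a$. Let $L$ be an invertible linear operator on $\mathcal H_m\otimes\mathcal H_n$. Then the following are equivalent: (a) there exists some $1\le k<\min\{m,n\}$ such that $L\mathcal S_k\subseteq\mathcal S_k$; (b) $L\mathcal S_k=\mathcal S_k$ for all $1\le k\le\min\{m,n\}$; (c) there are nonsingular operators $P$ on $\mathcal H_m$ and $Q$ on $\mathcal H_n$ such that $L=P\otimes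 Q$, or $m=n$ and $L=S(P\otimes Q)$. Furthermore, if $L$ satisfies these equivalent conditions and, for some $1\le k\le\min\{m,n\}$, sends every pure state in $\mathcal S_k$ to a pure state (that is, $\|Lv\|=1$ for all $v\in\mathcal S_k$ with $\|v\|=1$), then $L$ is unitary and there are unitary operators $W$ on $\mathcal H_m$ and $Y$ on $\mathcal H_n$ such that $L=W\otimes Y$, or $m=n$ and $L=S(W\otimes Y)$. -/

import Mathlib

open scoped TensorProduct

noncomputable section

namespace SchmidtPreserver

/-- The `n`-dimensional complex Hilbert space. -/
abbrev Hilb (n : ℕ) : Type := EuclideanSpace ℂ (Fin n)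

/-- The bipartite Hilbert space, with Mathlib's inner product on tensor products,
`⟪a ⊗ b, c ⊗ d⟫ = ⟪a, c⟫ * ⟪b, d⟫`. -/
abbrev Bipartite (m n : ℕ) : Type := Hilb m ⊗[ℂ] Hilb n

/-- The vector-operator isomorphism: the linear map with
`a ⊗ b ↦ (x ↦ (∑ j, b j * x j) • a)`, i.e. `a ⊗ b` is sent to the rank one operator
`|a⟩⟨conj b|`. -/
def vecToOp (m n : ℕ) : Bipartite m n →ₗ[ℂ] (Hilb n →ₗ[ℂ] Hilb m) :=
  TensorProduct.lift <| LinearMap.mk₂ ℂ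
    (fun (a : Hilb m) (b : Hilb n) =>
      (∑ j, b j • (EuclideanSpace.proj j : Hilb n →L[ℂ] ℂ).toLinearMap).smulRight a)
    (fun a a' b => by ext x i; simp)
    (fun c a b => by ext x i; simp; ring)
    (fun a b b' => by ext x i; simp [add_mul, Finset.sum_add_distrib])
    (fun c a b => by ext x i; simp [Finset.mul_sum, Finset.sum_mul, mul_assoc])

theorem vecToOp_tmul {m n : ℕ} (a : Hilb m) (b x : Hilb n) :
    vecToOp m n (a ⊗ₜ[ℂ] b) x = (∑ j, b j * x j) • a := by
  simp [vecToOp]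

/-- The Schmidt rank: the rank of the operator associated with the vector. -/
def schmidtRank {m n : ℕ} (v : Bipartite m n) : ℕ :=
  Module.finrank ℂ (LinearMap.range (vecToOp m n v))

/-- The Schmidt rank is the number of terms of any Schmidt decomposition of the vector. -/
theorem schmidtRank_sum {m n k : ℕ} (α : Fin k → ℝ) (hα : ∀ i, 0 < α i)
    (a : Fin k → Hilb m) (ha : Orthonormal ℂ a) (b : Fin k → Hilb n) (hb : Orthonormal ℂ b) :
    schmidtRank (∑ i, (α i : ℂ) • (a i ⊗ₜ[ℂ] b i)) = k := by
  have hx : ∀ x, vecToOp m n (∑ i, (α i : ℂ) • (a i ⊗ₜ[ℂ] b i)) x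
      = ∑ i, ((α i : ℂ) * ∑ j, b i j * x j) • a i := by
    intro x
    simp [-Complex.coe_smul, map_sum, vecToOp_tmul, smul_smul]
  have hr : LinearMap.range (vecToOp m n (∑ i, (α i : ℂ) • (a i ⊗ₜ[ℂ] b i)))
      = Submodule.span ℂ (Set.range a) := by
    apply le_antisymm
    · rintro _ ⟨x, rfl⟩
      rw [hx]
      exact Submodule.sum_mem _ fun i _ =>
        Submodule.smul_mem _ _ (Submodule.subset_span ⟨i, rfl⟩)
    · rw [Submodule.span_le]
      rintro _ ⟨i, rfl⟩
      refine ⟨((α i : ℂ)⁻¹) • WithLp.toLp 2 (fun j => star (b i j)), ?_⟩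
      rw [map_smul, hx]
      have hb' : ∀ i', (∑ j, b i' j * star (b i j)) = if i = i' then 1 else 0 := by
        intro i'
        rw [← orthonormal_iff_ite.1 hb i i']
        simp [PiLp.inner_apply]
      have h0 : (α i : ℂ) ≠ 0 := by exact_mod_cast (hα i).ne'
      simp only [hb', mul_ite, mul_one, mul_zero, ite_smul, zero_smul]
      simp [-Complex.coe_smul, smul_smul, h0]
  rw [schmidtRank, hr, finrank_span_eq_card ha.linearIndependent, Fintype.card_fin]

/-- The set of real multiples `c|w⟩` of pure states (unit vectors) `|w⟩` of Schmidt rank at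
most `k`. -/
def schmidtSet (m n k : ℕ) : Set (Bipartite m n) :=
  {v | ∃ (c : ℝ) (w : Bipartite m n), ‖w‖ = 1 ∧ schmidtRank w ≤ k ∧ v = (c : ℂ) • w}

/-- For `m = n`, the identification of the two factors (the identity when `m` is literally `n`). -/
def identify {m n : ℕ} (h : m = n) : Hilb m ≃ₗᵢ[ℂ] Hilb n :=
  LinearIsometryEquiv.piLpCongrLeft 2 ℂ ℂ (finCongr h)

/-- The swap operator `a ⊗ b ↦ b ⊗ a`, available when `m = n`. -/
def swap {m n : ℕ} (h : m = n) : Module.End ℂ (Bipartite m n) :=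
  TensorProduct.map (identify h).symm.toLinearEquiv.toLinearMap
      (identify h).toLinearEquiv.toLinearMap
    ∘ₗ (TensorProduct.comm ℂ (Hilb m) (Hilb n)).toLinearMap

theorem swap_tmul {n : ℕ} (a b : Hilb n) :
    swap (rfl : n = n) (a ⊗ₜ[ℂ] b) = b ⊗ₜ[ℂ] a := by
  have h : identify (rfl : n = n) = LinearIsometryEquiv.refl ℂ (Hilb n) := by
    ext x i; simp [identify, Equiv.piCongrLeft']
  simp [swap, h]

/-- `L = P ⊗ Q`, or `m = n` and `L = S (P ⊗ Q)`, with `P` and `Q` nonsingular. -/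
def IsLocalForm {m n : ℕ} (L : Module.End ℂ (Bipartite m n)) : Prop :=
  ∃ (P : Module.End ℂ (Hilb m)) (Q : Module.End ℂ (Hilb n)), IsUnit P ∧ IsUnit Q ∧
    (L = TensorProduct.map P Q ∨ ∃ h : m = n, L = swap h ∘ₗ TensorProduct.map P Q)

/-- `L = W ⊗ Y`, or `m = n` and `L = S (W ⊗ Y)`, with `W` and `Y` unitary. -/
def IsLocalUnitaryForm {m n : ℕ} (L : Module.End ℂ (Bipartite m n)) : Prop :=
  ∃ (W : Hilb m →ₗ[ℂ] Hilb m) (Y : Hilb n →ₗ[ℂ] Hilb n),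
    W ∈ unitary (Hilb m →ₗ[ℂ] Hilb m) ∧ Y ∈ unitary (Hilb n →ₗ[ℂ] Hilb n) ∧
    (L = TensorProduct.map W Y ∨ ∃ h : m = n, L = swap h ∘ₗ TensorProduct.map W Y)

end SchmidtPreserver

end

/-! In the product basis the Schmidt rank is a matrix rank, so the hard implication (a) ⇒ (c)
concerns a bijective linear map `L` on matrices that keeps rank at most `k`. The crux is descent to
`k = 1` (`exists_vecMulVec_of_rank_preserver`). A minor of `L X` of size `k + 1` is a homogeneous
polynomial in `X` of degree `k + 1` that vanishes at rank at most `k`. In coordinates along rank one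
matrices it is squarefree, hence affine along every line `B + t • A` with `A` of rank one
(`det_affine`). If `L A` had a non-zero minor of size two, surjectivity would give a `B` for which a
larger minor equals `t ^ 2` times a function non-zero at `0`, which is not affine.

Thus `L` preserves pure tensors. Each section `L (a ⊗ ·)` is a linear space of pure tensors, so one
of its factors is constant; the two kinds of section cannot coexist, and they give `P ⊗ Q` and its
swap respectively (`pure_preserver`).

Conversely, local maps multiply the coefficient matrix by invertible matrices and the swap
transposes it, so rank is kept. For the last claim, norms of product vectors alone force `P` and `Q`
to be multiples of isometries. -/

namespace SchmidtPreserver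

/-! ### Linear preservers of pure tensors, over any field. -/

section PureTensors

variable {K V W V' W' : Type*} [Field K] [AddCommGroup V] [Module K V] [AddCommGroup W] [Module K W]
  [AddCommGroup V'] [Module K V'] [AddCommGroup W'] [Module K W']

/-- A tensor of the form `a ⊗ b`. -/
def IsPure (v : V ⊗[K] W) : Prop := ∃ a b, v = a ⊗ₜ[K] b

/-- Contraction of the left factor with a functional. -/
def contractLeft (φ : Module.Dual K V) : V ⊗[K] W →ₗ[K] W :=
  (TensorProduct.lid K W).toLinearMap ∘ₗ TensorProduct.map φ LinearMap.id

/-- Contraction of the right factor with a functional. -/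
def contractRight (φ : Module.Dual K W) : V ⊗[K] W →ₗ[K] V :=
  (TensorProduct.rid K V).toLinearMap ∘ₗ TensorProduct.map LinearMap.id φ

@[simp]
theorem contractLeft_tmul (φ : Module.Dual K V) (a : V) (b : W) :
    contractLeft φ (a ⊗ₜ[K] b) = φ a • b := by
  simp [contractLeft]

@[simp]
theorem contractRight_tmul (φ : Module.Dual K W) (a : V) (b : W) :
    contractRight φ (a ⊗ₜ[K] b) = φ b • a := by
  simp [contractRight]

theorem exists_dual_eq_one {a : V} (ha : a ≠ 0) : ∃ φ : Module.Dual K V, φ a = 1 := by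
  obtain ⟨f, hf⟩ := Module.Projective.exists_dual_ne_zero K ha
  exact ⟨(f a)⁻¹ • f, by simp [hf]⟩

theorem IsPure.comm {v : V ⊗[K] W} (h : IsPure v) : IsPure (TensorProduct.comm K V W v) := by
  obtain ⟨a, b, rfl⟩ := h
  exact ⟨b, a, by simp⟩

theorem tmul_ne_zero {a : V} {b : W} (ha : a ≠ 0) (hb : b ≠ 0) : a ⊗ₜ[K] b ≠ 0 := by
  obtain ⟨φ, hφ⟩ := exists_dual_eq_one (K := K) ha
  intro h
  apply hb
  simpa [hφ] using congrArg (contractLeft φ) h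

/-- If `a ⊗ b = c ⊗ d` with `a ≠ 0`, then `b` is a multiple of `d`. -/
theorem exists_smul_of_tmul_eq {a c : V} {b d : W} (ha : a ≠ 0) (h : a ⊗ₜ[K] b = c ⊗ₜ[K] d) :
    ∃ r : K, b = r • d := by
  obtain ⟨φ, hφ⟩ := exists_dual_eq_one (K := K) ha
  exact ⟨φ c, by simpa [hφ] using congrArg (contractLeft φ) h⟩

/-- If a sum of two pure tensors is pure, then they share a factor up to scalars. -/
theorem IsPure.parallel {a₁ a₂ : V} {b₁ b₂ : W} (ha : a₁ ≠ 0) (hb : b₁ ≠ 0)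
    (h : IsPure (a₁ ⊗ₜ[K] b₁ + a₂ ⊗ₜ[K] b₂)) :
    (∃ c : K, a₂ = c • a₁) ∨ ∃ c : K, b₂ = c • b₁ := by
  by_cases hp : a₂ ∈ K ∙ a₁
  · obtain ⟨c, hc⟩ := Submodule.mem_span_singleton.1 hp
    exact Or.inl ⟨c, hc.symm⟩
  right
  obtain ⟨c, d, h⟩ := h
  -- `f` kills `a₁` but not `a₂`, so contracting with it puts `b₂` on the line of `d`; contracting
  -- with `g` then puts `b₁` there too.
  obtain ⟨f, hf, hf'⟩ := Submodule.exists_dual_map_eq_bot_of_notMem hp inferInstance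
  have hf1 : f a₁ = 0 := by
    have : f a₁ ∈ Submodule.map f (K ∙ a₁) := ⟨a₁, Submodule.mem_span_singleton_self a₁, rfl⟩
    simpa [hf'] using this
  have h2 : f a₂ • b₂ = f c • d := by simpa [hf1] using congrArg (contractLeft f) h
  obtain ⟨g, hg⟩ := exists_dual_eq_one (K := K) ha
  have h1 : b₁ + g a₂ • b₂ = g c • d := by simpa [hg] using congrArg (contractLeft g) h
  have hb2 : b₂ = ((f a₂)⁻¹ * f c) • d := by rw [mul_smul, ← h2, inv_smul_smul₀ hf]
  have hb1 : b₁ = (g c - g a₂ * ((f a₂)⁻¹ * f c)) • d := by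
    rw [sub_smul, ← h1, mul_smul, ← hb2, add_sub_cancel_right]
  set r := g c - g a₂ * ((f a₂)⁻¹ * f c)
  have hr : r ≠ 0 := by
    rintro h0
    rw [h0, zero_smul] at hb1
    exact hb hb1
  refine ⟨((f a₂)⁻¹ * f c) * r⁻¹, ?_⟩
  rw [hb1, smul_smul, inv_mul_cancel_right₀ hr, hb2]

/-- A linear space of pure tensors has a constant left factor or a constant right factor. -/
theorem exists_common_factor [Nontrivial W] (T : W →ₗ[K] V' ⊗[K] W')
    (hT : Function.Injective T) (hp : ∀ y, IsPure (T y)) :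
    (∃ (a : V') (Q : W →ₗ[K] W'), ∀ y, T y = a ⊗ₜ[K] Q y) ∨
      ∃ (R : W →ₗ[K] V') (b : W'), ∀ y, T y = R y ⊗ₜ[K] b := by
  choose α β hαβ using hp
  have hα : ∀ y, y ≠ 0 → α y ≠ 0 := fun y hy h0 =>
    hy (hT (by rw [hαβ, h0, TensorProduct.zero_tmul, map_zero]))
  have hβ : ∀ y, y ≠ 0 → β y ≠ 0 := fun y hy h0 =>
    hy (hT (by rw [hαβ, h0, TensorProduct.tmul_zero, map_zero]))
  have hpar : ∀ y z, y ≠ 0 → (∃ c : K, α z = c • α y) ∨ ∃ c : K, β z = c • β y := fun y z hy =>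
    IsPure.parallel (hα y hy) (hβ y hy)
      ⟨α (y + z), β (y + z), by rw [← hαβ, ← hαβ, ← map_add, hαβ]⟩
  obtain ⟨y₁, hy₁⟩ := exists_ne (0 : W)
  by_cases hall : ∀ z, z ≠ 0 → ∃ c : K, α z = c • α y₁
  · left
    -- The chosen `α` and `β` need not be linear; contracting `T` with `φ` produces a linear factor.
    obtain ⟨φ, hφ⟩ := exists_dual_eq_one (K := K) (hα y₁ hy₁)
    refine ⟨α y₁, contractLeft φ ∘ₗ T, fun y => ?_⟩
    rcases eq_or_ne y 0 with rfl | hy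
    · simp
    obtain ⟨c, hc⟩ := hall y hy
    rw [LinearMap.comp_apply, hαβ y, hc, contractLeft_tmul, map_smul, hφ, TensorProduct.smul_tmul,
      smul_eq_mul, mul_one]
  · right
    push Not at hall
    obtain ⟨y₂, hy₂0, hy₂⟩ := hall
    obtain ⟨d, hd⟩ : ∃ c : K, β y₂ = c • β y₁ :=
      (hpar y₁ y₂ hy₁).resolve_left fun ⟨c, hc⟩ => hy₂ c hc
    -- If `α z` is parallel to `α y₁`, then `α y₂` is not a multiple of `α z`, so `y₂` links `β z`
    -- to `β y₁`.
    have hb : ∀ z, z ≠ 0 → ∃ c : K, β z = c • β y₁ := by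
      intro z hz
      rcases hpar y₁ z hy₁ with ⟨c, hc⟩ | h
      · obtain ⟨c', hc'⟩ : ∃ c : K, β y₂ = c • β z :=
          (hpar z y₂ hz).resolve_left fun ⟨e, he⟩ => hy₂ (e * c) (by rw [he, hc, smul_smul])
        have h0 : c' ≠ 0 := by
          rintro rfl
          exact hβ y₂ hy₂0 (by rw [hc', zero_smul])
        exact ⟨c'⁻¹ * d, by rw [mul_smul, ← hd, hc', inv_smul_smul₀ h0]⟩
      · exact h
    obtain ⟨φ, hφ⟩ := exists_dual_eq_one (K := K) (hβ y₁ hy₁)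
    refine ⟨contractRight φ ∘ₗ T, β y₁, fun y => ?_⟩
    rcases eq_or_ne y 0 with rfl | hy
    · simp
    obtain ⟨c, hc⟩ := hb y hy
    rw [LinearMap.comp_apply, hαβ y, hc, contractRight_tmul, map_smul, hφ, TensorProduct.tmul_smul,
      smul_eq_mul, mul_one, TensorProduct.smul_tmul']

open Module

/-- The left sections of an injective preserver of pure tensors cannot be of both kinds. -/
theorem false_of_mixed_sections [FiniteDimensional K W] [FiniteDimensional K W']
    (hd : finrank K W = finrank K W') (hW : 2 ≤ finrank K W)
    {L : V ⊗[K] W →ₗ[K] V' ⊗[K] W'} (hL : Function.Injective L)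
    (hp : ∀ a b, IsPure (L (a ⊗ₜ b))) {a₁ a₂ : V} (ha₁ : a₁ ≠ 0) (ha₂ : a₂ ≠ 0)
    {a' : V'} {Q : W →ₗ[K] W'} (h₁ : ∀ y, L (a₁ ⊗ₜ y) = a' ⊗ₜ Q y)
    {R : W →ₗ[K] V'} {b' : W'} (h₂ : ∀ y, L (a₂ ⊗ₜ y) = R y ⊗ₜ b') : False := by
  have hL0 : ∀ {a : V} {y : W}, a ≠ 0 → y ≠ 0 → L (a ⊗ₜ y) ≠ 0 := fun ha hy h =>
    tmul_ne_zero ha hy (hL (by rw [h, map_zero]))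
  have hQ0 : ∀ y, y ≠ 0 → Q y ≠ 0 := fun y hy h =>
    hL0 ha₁ hy (by rw [h₁, h, TensorProduct.tmul_zero])
  have hQi : Function.Injective Q := by
    rw [injective_iff_map_eq_zero]
    intro y hy
    by_contra h
    exact hQ0 y h hy
  have hQs : Function.Surjective Q := (LinearMap.injective_iff_surjective_of_finrank_eq_finrank hd).1 hQi
  -- Either `Q y` is parallel to `b'` at once, or `R y = c • a'`; then `Q y' = c • b'` for some
  -- `y'`, and injectivity of `L` makes `y` a multiple of `y'`. So `Q` would have rank at most one.
  have key : ∀ y, Q y ∈ K ∙ b' := by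
    intro y
    rcases eq_or_ne y 0 with rfl | hy
    · simp
    have ha' : a' ≠ 0 := by
      rintro rfl
      exact hL0 ha₁ hy (by rw [h₁, TensorProduct.zero_tmul])
    have hb' : b' ≠ 0 := by
      rintro rfl
      exact hL0 ha₂ hy (by rw [h₂, TensorProduct.tmul_zero])
    have hsum : IsPure (a' ⊗ₜ[K] Q y + R y ⊗ₜ[K] b') := by
      rw [← h₁, ← h₂, ← map_add, ← TensorProduct.add_tmul]
      exact hp _ _
    rw [Submodule.mem_span_singleton]
    rcases hsum.parallel ha' (hQ0 y hy) with ⟨c, hc⟩ | ⟨c, hc⟩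
    · have hc0 : c ≠ 0 := by
        rintro rfl
        exact hL0 ha₂ hy (by rw [h₂, hc, zero_smul, TensorProduct.zero_tmul])
      obtain ⟨y', hy'⟩ := hQs (c • b')
      have hLL : L (a₁ ⊗ₜ y') = L (a₂ ⊗ₜ y) := by
        rw [h₁, h₂, hy', hc, TensorProduct.smul_tmul]
      obtain ⟨d, hd⟩ := exists_smul_of_tmul_eq ha₂ (hL hLL).symm
      refine ⟨d * c, ?_⟩
      rw [mul_smul, ← hy', ← map_smul, ← hd]
    · have hc0 : c ≠ 0 := by
        rintro rfl
        exact hb' (by rw [hc, zero_smul])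
      exact ⟨c⁻¹, by rw [hc, inv_smul_smul₀ hc0]⟩
  have h1 : finrank K (LinearMap.range Q) ≤ 1 := by
    refine le_trans (Submodule.finrank_mono (t := K ∙ b') ?_) ((finrank_span_le_card {b'}).trans (by simp))
    rintro _ ⟨y, rfl⟩
    exact key y
  rw [LinearMap.finrank_range_of_inj hQi] at h1
  omega

/-- If all left sections have a constant left factor, the preserver is a tensor product. -/
theorem exists_eq_map_of_sections [Nontrivial V] [Nontrivial W] [FiniteDimensional K W]
    [FiniteDimensional K W'] (hd : finrank K W = finrank K W')
    {L : V ⊗[K] W →ₗ[K] V' ⊗[K] W'} (hL : Function.Injective L)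
    (hp : ∀ a b, IsPure (L (a ⊗ₜ b)))
    (h : ∀ a : V, a ≠ 0 → ∃ (a' : V') (Q : W →ₗ[K] W'), ∀ y, L (a ⊗ₜ y) = a' ⊗ₜ Q y) :
    ∃ (P : V →ₗ[K] V') (Q : W →ₗ[K] W'), L = TensorProduct.map P Q := by
  have hL0 : ∀ {a : V} {y : W}, a ≠ 0 → y ≠ 0 → L (a ⊗ₜ y) ≠ 0 := fun ha hy h =>
    tmul_ne_zero ha hy (hL (by rw [h, map_zero]))
  obtain ⟨a₁, ha₁⟩ := exists_ne (0 : V)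
  obtain ⟨y₁, hy₁⟩ := exists_ne (0 : W)
  obtain ⟨a₁', Q, h₁⟩ := h a₁ ha₁
  have hQ0 : ∀ y, y ≠ 0 → Q y ≠ 0 := fun y hy h =>
    hL0 ha₁ hy (by rw [h₁, h, TensorProduct.tmul_zero])
  have ha₁' : a₁' ≠ 0 := by
    rintro rfl
    exact hL0 ha₁ hy₁ (by rw [h₁, TensorProduct.zero_tmul])
  have hQi : Function.Injective Q := by
    rw [injective_iff_map_eq_zero]
    intro y hy
    by_contra h
    exact hQ0 y h hy
  let e : W ≃ₗ[K] W' := LinearMap.linearEquivOfInjective Q hQi hd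
  have he : ∀ y, e y = Q y := fun y => rfl
  have hform : ∀ a : V, a ≠ 0 → ∃ a'' : V', ∀ y, L (a ⊗ₜ y) = a'' ⊗ₜ Q y := by
    intro a₂ ha₂
    obtain ⟨a₂', Q₂, h₂⟩ := h a₂ ha₂
    have key : ∀ y, y ≠ 0 → ∃ d : K, Q₂ y = d • Q y := by
      intro y hy
      have hsum : IsPure (a₁' ⊗ₜ[K] Q y + a₂' ⊗ₜ[K] Q₂ y) := by
        rw [← h₁, ← h₂, ← map_add, ← TensorProduct.add_tmul]
        exact hp _ _
      rcases hsum.parallel ha₁' (hQ0 y hy) with ⟨c, hc⟩ | h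
      · have hc0 : c ≠ 0 := by
          rintro rfl
          exact hL0 ha₂ hy (by rw [h₂, hc, zero_smul, TensorProduct.zero_tmul])
        have hy' : Q (e.symm (c • Q₂ y)) = c • Q₂ y := by rw [← he, e.apply_symm_apply]
        have hLL : L (a₁ ⊗ₜ e.symm (c • Q₂ y)) = L (a₂ ⊗ₜ y) := by
          rw [h₁, h₂, hy', hc, TensorProduct.smul_tmul]
        obtain ⟨d, hd⟩ := exists_smul_of_tmul_eq ha₁ (hL hLL)
        refine ⟨c⁻¹ * d, ?_⟩
        rw [mul_smul, ← map_smul, ← hd, hy', inv_smul_smul₀ hc0]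
      · exact h
    -- The map `e⁻¹ ∘ Q₂` sends every vector to a multiple of itself, hence is a scalar, which the
    -- left factor absorbs.
    obtain ⟨r, hr⟩ := LinearMap.exists_eq_smul_id_of_forall_notLinearIndependent
      (f := e.symm.toLinearMap ∘ₗ Q₂) (fun y => by
        rcases eq_or_ne y 0 with rfl | hy
        · intro hli
          exact hli.ne_zero 0 rfl
        rw [LinearIndependent.pair_iff' hy]
        push Not
        obtain ⟨d, hd⟩ := key y hy
        refine ⟨d, ?_⟩
        rw [LinearMap.comp_apply, hd, map_smul, ← he]
        simp)
    refine ⟨r • a₂', fun y => ?_⟩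
    have h3 : Q₂ y = r • Q y := by
      rw [← he, ← map_smul, ← LinearEquiv.symm_apply_eq]
      exact LinearMap.congr_fun hr y
    rw [h₂, h3, TensorProduct.smul_tmul]
  obtain ⟨ψ, hψ⟩ := exists_dual_eq_one (K := K) (hQ0 y₁ hy₁)
  refine ⟨contractRight ψ ∘ₗ L ∘ₗ (TensorProduct.mk K V W).flip y₁, Q, ?_⟩
  ext a y
  rcases eq_or_ne a 0 with rfl | ha
  · simp
  obtain ⟨a'', h''⟩ := hform a ha
  simp [h'', hψ]

/-- Injective preservers of pure tensors, when the left factor is not the larger one. -/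
theorem pure_preserver_of_finrank_le [FiniteDimensional K V] [FiniteDimensional K W]
    (hVW : finrank K V ≤ finrank K W) (hV : 2 ≤ finrank K V)
    {L : V ⊗[K] W →ₗ[K] V ⊗[K] W} (hL : Function.Injective L)
    (hp : ∀ a b, IsPure (L (a ⊗ₜ b))) :
    (∃ (P : V →ₗ[K] V) (Q : W →ₗ[K] W), L = TensorProduct.map P Q) ∨
      finrank K V = finrank K W ∧ ∃ (P : V →ₗ[K] W) (Q : W →ₗ[K] V),
        L = (TensorProduct.comm K W V).toLinearMap ∘ₗ TensorProduct.map P Q := by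
  have : Nontrivial V := nontrivial_of_finrank_pos (R := K) (by omega)
  have : Nontrivial W := nontrivial_of_finrank_pos (R := K) (by omega)
  have hinj : ∀ a : V, a ≠ 0 → Function.Injective (L ∘ₗ TensorProduct.mk K V W a) := by
    intro a ha
    rw [injective_iff_map_eq_zero]
    intro y hy
    by_contra h
    exact tmul_ne_zero ha h (hL (by rw [map_zero]; exact hy))
  have hsec := fun (a : V) (ha : a ≠ 0) =>
    exists_common_factor (L ∘ₗ TensorProduct.mk K V W a) (hinj a ha) (fun y => hp a y)
  simp only [LinearMap.comp_apply, TensorProduct.mk_apply] at hsec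
  by_cases hI : ∀ a : V, a ≠ 0 → ∃ (a' : V) (Q : W →ₗ[K] W), ∀ y, L (a ⊗ₜ y) = a' ⊗ₜ Q y
  · exact Or.inl (exists_eq_map_of_sections rfl hL hp hI)
  right
  rw [not_forall] at hI
  obtain ⟨a₂, hI⟩ := hI
  rw [Classical.not_imp] at hI
  obtain ⟨ha₂, hI⟩ := hI
  obtain ⟨R, b', hR⟩ := (hsec a₂ ha₂).resolve_left hI
  have hII : ∀ a : V, a ≠ 0 → ∃ (R : W →ₗ[K] V) (b : W), ∀ y, L (a ⊗ₜ y) = R y ⊗ₜ b :=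
    fun a ha => (hsec a ha).resolve_left fun ⟨_, _, h⟩ =>
      false_of_mixed_sections rfl (hV.trans hVW) hL hp ha ha₂ h hR
  have hRi : Function.Injective R := by
    rw [injective_iff_map_eq_zero]
    intro y hy
    by_contra h
    exact tmul_ne_zero ha₂ h (hL (by rw [map_zero, hR, hy, TensorProduct.zero_tmul]))
  have hd : finrank K V = finrank K W :=
    le_antisymm hVW (LinearMap.finrank_le_finrank_of_injective hRi)
  refine ⟨hd, ?_⟩
  obtain ⟨P, Q, hPQ⟩ := exists_eq_map_of_sections (V := V) (W := W) hd.symm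
    (L := (TensorProduct.comm K V W).toLinearMap ∘ₗ L)
    ((TensorProduct.comm K V W).injective.comp hL) (fun a b => (hp a b).comm) (fun a ha => by
      obtain ⟨R, b, h⟩ := hII a ha
      exact ⟨b, R, fun y => by simp [h]⟩)
  refine ⟨P, Q, ?_⟩
  rw [← hPQ, ← LinearMap.comp_assoc]
  ext; simp

/-- An injective preserver of pure tensors is `P ⊗ Q`, up to a swap when the factors have the same
dimension. -/
theorem pure_preserver [FiniteDimensional K V] [FiniteDimensional K W]
    (hV : 2 ≤ finrank K V) (hW : 2 ≤ finrank K W)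
    {L : V ⊗[K] W →ₗ[K] V ⊗[K] W} (hL : Function.Injective L)
    (hp : ∀ a b, IsPure (L (a ⊗ₜ b))) :
    (∃ (P : V →ₗ[K] V) (Q : W →ₗ[K] W), L = TensorProduct.map P Q) ∨
      finrank K V = finrank K W ∧ ∃ (P : V →ₗ[K] W) (Q : W →ₗ[K] V),
        L = (TensorProduct.comm K W V).toLinearMap ∘ₗ TensorProduct.map P Q := by
  rcases le_or_gt (finrank K V) (finrank K W) with h | h
  · exact pure_preserver_of_finrank_le h hV hL hp
  left
  have h' := pure_preserver_of_finrank_le (V := W) (W := V) h.le hW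
    (L := (TensorProduct.comm K V W).toLinearMap ∘ₗ L ∘ₗ (TensorProduct.comm K W V).toLinearMap)
    ((TensorProduct.comm K V W).injective.comp (hL.comp (TensorProduct.comm K W V).injective))
    (fun a b => by simpa using (hp b a).comm)
  rcases h' with ⟨Q, P, hPQ⟩ | ⟨hd, -⟩
  · refine ⟨P, Q, ?_⟩
    ext a b
    have := congrArg (TensorProduct.comm K W V) (LinearMap.congr_fun hPQ (b ⊗ₜ a))
    simpa [← LinearEquiv.symm_apply_eq] using this
  · omega

end PureTensors

/-! ### Squarefree homogeneous polynomials. -/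

section PolynomialPart

open MvPolynomial Finset

variable {σ : Type*} {N : ℕ}

/-- A homogeneous polynomial of degree `N` vanishing at all points with fewer than `N` non-zero
coordinates is squarefree. -/
theorem le_one_of_mem_support {g : MvPolynomial σ ℂ} (hg : g.IsHomogeneous N)
    (hv : ∀ (c : σ → ℂ) (S : Finset σ), S.card < N → (∀ i, i ∉ S → c i = 0) → eval c g = 0)
    {d : σ →₀ ℕ} (hd : d ∈ g.support) (i : σ) : d i ≤ 1 := by
  classical
  by_contra hi
  have hdeg : ∑ j ∈ d.support, d j = N := by
    have := hg (mem_support_iff.1 hd)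
    simpa [Finsupp.weight_apply, Finsupp.sum] using this
  have hcard : d.support.card < N := by
    rw [← hdeg, Finset.card_eq_sum_ones]
    refine Finset.sum_lt_sum (fun j hj => Nat.one_le_iff_ne_zero.2 (Finsupp.mem_support_iff.1 hj))
      ⟨i, Finsupp.mem_support_iff.2 (by omega), by omega⟩
  -- A repeated variable leaves `d` with fewer than `N` variables. The part `g₁` of `g` in these
  -- variables is `g` with the others set to `0`, so it vanishes identically, though it contains
  -- `d`.
  let g₁ : MvPolynomial σ ℂ :=
    ∑ e ∈ g.support.filter (fun e => e.support ⊆ d.support), monomial e (coeff e g)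
  have hg₁ : g₁ = 0 := by
    refine MvPolynomial.funext fun c => ?_
    rw [map_zero, ← hv (fun j => if j ∈ d.support then c j else 0) d.support hcard
      (fun j hj => if_neg hj), map_sum, eval_eq, Finset.sum_filter]
    refine Finset.sum_congr rfl fun e _ => ?_
    split_ifs with he
    · rw [eval_monomial, Finsupp.prod]
      congr 1
      exact Finset.prod_congr rfl fun j hj => by rw [if_pos (he hj)]
    · obtain ⟨j, hj, hjd⟩ := Finset.not_subset.1 he
      rw [Finset.prod_eq_zero hj, mul_zero]
      rw [if_neg hjd, zero_pow (Finsupp.mem_support_iff.1 hj)]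
  have hc : coeff d g₁ = coeff d g := by
    rw [coeff_sum, Finset.sum_eq_single d]
    · simp
    · intro e _ he
      rw [coeff_monomial, if_neg he]
    · intro h
      exact absurd (Finset.mem_filter.2 ⟨hd, Finset.Subset.refl _⟩) h
  rw [hg₁, coeff_zero] at hc
  exact mem_support_iff.1 hd hc.symm

/-- A polynomial whose monomials have degree at most one in `X i` is affine in this variable. -/
theorem eval_update_affine [Fintype σ] [DecidableEq σ] {g : MvPolynomial σ ℂ} (i : σ)
    (hg : ∀ d ∈ g.support, d i ≤ 1) (c : σ → ℂ) (t : ℂ) :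
    eval (Function.update c i t) g = eval (Function.update c i 0) g +
      t * (eval (Function.update c i 1) g - eval (Function.update c i 0) g) := by
  have hsplit : ∀ s : ℂ, eval (Function.update c i s) g =
      ∑ d ∈ g.support, coeff d g * (s ^ d i * ∏ j ∈ univ.erase i, c j ^ d j) := by
    intro s
    rw [eval_eq']
    refine Finset.sum_congr rfl fun d _ => ?_
    rw [← Finset.mul_prod_erase univ _ (mem_univ i), Function.update_self]
    congr 2
    exact Finset.prod_congr rfl fun j hj => by
      rw [Function.update_of_ne (Finset.ne_of_mem_erase hj)]
  rw [hsplit, hsplit, hsplit, ← Finset.sum_sub_distrib, Finset.mul_sum, ← Finset.sum_add_distrib]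
  refine Finset.sum_congr rfl fun d hd => ?_
  have := hg d hd
  interval_cases d i <;> simp; ring

end PolynomialPart

/-! ### Descent from rank at most `k` to rank one. -/

section Matrices

open Matrix

variable {ρ γ : Type*}

theorem rank_add_le [Fintype γ] (A B : Matrix ρ γ ℂ) : (A + B).rank ≤ A.rank + B.rank := by
  have h : LinearMap.range (A + B).mulVecLin ≤
      LinearMap.range A.mulVecLin ⊔ LinearMap.range B.mulVecLin := by
    rw [mulVecLin_add]
    rintro _ ⟨x, rfl⟩
    exact Submodule.add_mem_sup ⟨x, rfl⟩ ⟨x, rfl⟩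
  exact (Submodule.finrank_mono h).trans (Submodule.finrank_add_le_finrank_add_finrank _ _)

theorem rank_sum_smul_le [Fintype γ] {ι : Type*} (s : Finset ι) (c : ι → ℂ) (X : ι → Matrix ρ γ ℂ)
    (hX : ∀ i, (X i).rank ≤ 1) : (∑ i ∈ s, c i • X i).rank ≤ s.card := by
  classical
  induction s using Finset.induction_on with
  | empty => simp
  | insert i s hi ih =>
    rw [Finset.sum_insert hi, Finset.card_insert_of_notMem hi, add_comm]
    refine (rank_add_le _ _).trans (add_le_add ih ?_)
    rcases eq_or_ne (c i) 0 with h | h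
    · simp [h]
    · rw [rank_smul_of_mem_nonZeroDivisors _ (mem_nonZeroDivisors_of_ne_zero h)]
      exact hX i

/-- A matrix all of whose minors of size two vanish is a product of a column and a row. -/
theorem eq_vecMulVec_of_minors {A : Matrix ρ γ ℂ}
    (h : ∀ i i' j j', A i j * A i' j' = A i j' * A i' j) : ∃ v w, A = vecMulVec v w := by
  by_cases h0 : A = 0
  · exact ⟨0, 0, by simp [h0]⟩
  obtain ⟨i, j, hij⟩ : ∃ i j, A i j ≠ 0 := by
    by_contra! hc
    exact h0 (by ext i j; simp [hc])
  refine ⟨fun i' => A i' j, fun j' => A i j' / A i j, ?_⟩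
  ext i' j'
  rw [vecMulVec_apply]
  field_simp
  linear_combination h i' i j' j

/-- Serves to enlarge a minor of size two to one of size `l + 2` having it as upper left corner. -/
theorem exists_injective_extend {ι : Type*} [Fintype ι] (i₀ i₁ : ι) (h : i₀ ≠ i₁) {l : ℕ}
    (hl : l + 2 ≤ Fintype.card ι) :
    ∃ e : Fin 2 ⊕ Fin l → ι, Function.Injective e ∧ e (Sum.inl 0) = i₀ ∧ e (Sum.inl 1) = i₁ := by
  classical
  have hc : Fintype.card {x : ι // x ∉ ({i₀, i₁} : Finset ι)} = Fintype.card ι - 2 := by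
    rw [Fintype.card_subtype_compl, Fintype.card_coe, Finset.card_pair h]
  obtain ⟨f⟩ : Nonempty (Fin l ↪ {x : ι // x ∉ ({i₀, i₁} : Finset ι)}) :=
    Function.Embedding.nonempty_of_card_le (by rw [hc, Fintype.card_fin]; omega)
  have hf : ∀ x, (f x : ι) ≠ i₀ ∧ (f x : ι) ≠ i₁ := fun x => by
    simpa using (f x).2
  refine ⟨Sum.elim ![i₀, i₁] (fun x => f x), ?_, rfl, rfl⟩
  refine Function.Injective.sumElim ?_ (Subtype.val_injective.comp f.injective) ?_
  · intro a b
    fin_cases a <;> fin_cases b <;> simp [h, h.symm]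
  · intro a b
    fin_cases a
    · exact (hf b).1.symm
    · exact (hf b).2.symm

/-- The minors of the image of `∑ i, c i • X i` are homogeneous polynomials in `c`. -/
theorem exists_det_polynomial {ι β : Type*} [Fintype ι] [Fintype β] [DecidableEq β]
    (L : Matrix ρ γ ℂ →ₗ[ℂ] Matrix ρ γ ℂ) (X : ι → Matrix ρ γ ℂ) (e : β → ρ) (e' : β → γ) :
    ∃ g : MvPolynomial ι ℂ, g.IsHomogeneous (Fintype.card β) ∧
      ∀ c, MvPolynomial.eval c g = ((L (∑ i, c i • X i)).submatrix e e').det := by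
  refine ⟨Matrix.det (Matrix.of fun a b => ∑ i, MvPolynomial.C (L (X i) (e a) (e' b)) *
    MvPolynomial.X i), ?_, fun c => ?_⟩
  · rw [det_apply]
    refine MvPolynomial.IsHomogeneous.sum _ _ _ fun τ _ => ?_
    have hprod : (∏ a, (Matrix.of fun a b => ∑ i, MvPolynomial.C (L (X i) (e a) (e' b)) *
        MvPolynomial.X i : Matrix β β (MvPolynomial ι ℂ)) (τ a) a).IsHomogeneous
        (∑ _a : β, 1) := by
      refine MvPolynomial.IsHomogeneous.prod _ _ _ fun a _ => ?_
      refine MvPolynomial.IsHomogeneous.sum _ _ _ fun i _ => ?_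
      simpa using MvPolynomial.isHomogeneous_C_mul_X (L (X i) (e (τ a)) (e' a)) i
    rw [Finset.sum_const, smul_eq_mul, mul_one, Finset.card_univ] at hprod
    rcases Int.units_eq_one_or (Equiv.Perm.sign τ) with hs | hs
    · simpa [hs] using hprod
    · rw [hs, Units.neg_smul, one_smul]
      exact hprod.neg
  · rw [RingHom.map_det]
    congr 1
    ext a b
    simp [Matrix.sum_apply, mul_comm]

/-- Translates by a rank one matrix act affinely on the pull-backs of minors that vanish on the
matrices of low rank. -/
theorem det_affine [Fintype ρ] [Fintype γ] [DecidableEq ρ] [DecidableEq γ]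
    {β : Type*} [Fintype β] [DecidableEq β]
    {L : Matrix ρ γ ℂ →ₗ[ℂ] Matrix ρ γ ℂ}
    (hL : ∀ X : Matrix ρ γ ℂ, X.rank < Fintype.card β → (L X).rank < Fintype.card β)
    (e : β → ρ) (e' : β → γ) {A : Matrix ρ γ ℂ} (hA : A.rank ≤ 1) (B : Matrix ρ γ ℂ) (t : ℂ) :
    ((L (B + t • A)).submatrix e e').det = ((L B).submatrix e e').det +
      t * (((L (B + A)).submatrix e e').det - ((L B).submatrix e e').det) := by
  -- An overcomplete system of rank one matrices: `A` gets its own variable `none`, and the matrix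
  -- units reach every `B`.
  let X : Option (ρ × γ) → Matrix ρ γ ℂ := fun o => o.elim A fun p => Matrix.single p.1 p.2 1
  have hX : ∀ o, (X o).rank ≤ 1 := by
    rintro (_ | ⟨i, j⟩)
    · exact hA
    · have : (Matrix.single i j (1 : ℂ)) = vecMulVec (Pi.single i 1) (Pi.single j 1) := by
        rw [Matrix.single_eq_single_vecMulVec_single]
      change (Matrix.single i j (1 : ℂ)).rank ≤ 1
      rw [this]
      exact rank_vecMulVec_le _ _
  obtain ⟨g, hg, hgv⟩ := exists_det_polynomial L X e e'
  have hsq : ∀ d ∈ g.support, d none ≤ 1 := fun d hd => by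
    refine le_one_of_mem_support hg (fun c S hS hc => ?_) hd none
    rw [hgv]
    by_contra hne
    have h1 : (∑ o, c o • X o).rank < Fintype.card β := by
      rw [← Finset.sum_subset (Finset.subset_univ S) (fun o _ ho => by rw [hc o ho, zero_smul])]
      exact (rank_sum_smul_le S c X hX).trans_lt hS
    have h2 := (rank_submatrix_le (L (∑ o, c o • X o)) e e').trans_lt (hL _ h1)
    rw [rank_of_det_ne_zero hne] at h2
    exact lt_irrefl _ h2
  have hval : ∀ s : ℂ, MvPolynomial.eval
      (Function.update (fun o : Option (ρ × γ) => o.elim 0 fun p => B p.1 p.2) none s) g =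
      ((L (B + s • A)).submatrix e e').det := by
    intro s
    rw [hgv, Fintype.sum_option]
    have hB : ∑ p : ρ × γ, B p.1 p.2 • Matrix.single p.1 p.2 (1 : ℂ) = B := by
      rw [Fintype.sum_prod_type]
      conv_rhs => rw [Matrix.matrix_eq_sum_single B]
      simp
    simp only [Function.update_self, Function.update_of_ne (Option.some_ne_none _), X,
      Option.elim_none, Option.elim_some, hB]
    rw [add_comm]
  have := eval_update_affine none hsq (fun o => o.elim 0 fun p => B p.1 p.2) t
  rw [hval, hval, hval] at this
  simpa using this

/-- A function of the form `t ^ 2 * h t` with `h` continuous and `h 0 ≠ 0` is not linear. -/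
theorem false_of_sq_mul_eq {h : ℂ → ℂ} (hc : Continuous h) (h0 : h 0 ≠ 0) {r : ℂ}
    (hr : ∀ t, t ^ 2 * h t = t * r) : False := by
  have h1 : ∀ t, t ≠ 0 → t * h t = r := fun t ht => by
    have := hr t
    have h2 : t * (t * h t) = t * r := by rw [← this]; ring
    exact mul_left_cancel₀ ht h2
  -- Continuity extends the cancelled identity to `t = 0`, giving `r = 0`; the same argument then
  -- gives `h = 0`.
  have heq : (fun t : ℂ => t * h t) = fun _ => r :=
    Continuous.ext_on (s := {0}ᶜ) (dense_compl_singleton 0) (continuous_id.mul hc)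
      continuous_const (fun t ht => h1 t ht)
  have hr0 : r = 0 := by simpa using (congrFun heq 0).symm
  have heq' : h = fun _ => (0 : ℂ) :=
    Continuous.ext_on (s := {0}ᶜ) (dense_compl_singleton 0) hc continuous_const (fun t ht => by
      have := h1 t ht
      rw [hr0] at this
      exact (mul_eq_zero.1 this).resolve_left ht)
  exact h0 (by rw [heq'])

/-- A bijective linear map that does not raise the rank of the matrices of rank at most `k`, with
`k` smaller than both sizes, sends matrices of rank at most one to such matrices. -/
theorem exists_vecMulVec_of_rank_preserver [Fintype ρ] [Fintype γ] [DecidableEq ρ] [DecidableEq γ]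
    {L : Matrix ρ γ ℂ →ₗ[ℂ] Matrix ρ γ ℂ}
    (hsurj : Function.Surjective L) {k : ℕ} (hk : 1 ≤ k) (hkρ : k < Fintype.card ρ)
    (hkγ : k < Fintype.card γ) (hL : ∀ X : Matrix ρ γ ℂ, X.rank ≤ k → (L X).rank ≤ k)
    {A : Matrix ρ γ ℂ} (hA : A.rank ≤ 1) : ∃ v w, L A = vecMulVec v w := by
  by_contra hcon
  have hminor : ∃ i i' j j', L A i j * L A i' j' ≠ L A i j' * L A i' j := by
    by_contra! h
    exact hcon (eq_vecMulVec_of_minors h)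
  obtain ⟨i, i', j, j', hne⟩ := hminor
  have hii : i ≠ i' := by rintro rfl; exact hne (mul_comm _ _)
  have hjj : j ≠ j' := by rintro rfl; exact hne rfl
  obtain ⟨l, rfl⟩ : ∃ l, k = l + 1 := ⟨k - 1, by omega⟩
  obtain ⟨e, he, he0, he1⟩ := exists_injective_extend i i' hii (l := l) (by omega)
  obtain ⟨e', he', he0', he1'⟩ := exists_injective_extend j j' hjj (l := l) (by omega)
  have hcard : Fintype.card (Fin 2 ⊕ Fin l) = l + 2 := by simp [add_comm]
  -- With `k = l + 1` these minors have size `k + 1`. The zero corner of `D` sits where `M` has its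
  -- non-zero minor.
  let D : Matrix (Fin 2 ⊕ Fin l) (Fin 2 ⊕ Fin l) ℂ := fromBlocks 0 0 0 1
  obtain ⟨B, hB⟩ : ∃ B, (L B).submatrix e e' = D := by
    obtain ⟨B, hB⟩ := hsurj (Matrix.of fun x y =>
      D (Function.invFun e x) (Function.invFun e' y))
    refine ⟨B, ?_⟩
    rw [hB]
    ext a b
    simp [Function.leftInverse_invFun he a, Function.leftInverse_invFun he' b]
  set M := (L A).submatrix e e' with hM
  have haff : ∀ t : ℂ, (D + t • M).det = t * (D + M).det := by
    intro t
    have hD : D.det = 0 := by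
      simp only [D, det_fromBlocks_zero₁₂]
      simp
    have := det_affine (β := Fin 2 ⊕ Fin l) (L := L)
      (fun X hX => by
        rw [hcard] at hX ⊢
        have := hL X (by omega)
        omega) e e' hA B t
    have hsub : ∀ s : ℂ, (L (B + s • A)).submatrix e e' = D + s • M := by
      intro s
      rw [map_add, map_smul, ← hB, hM]
      rfl
    have h1 : (L (B + A)).submatrix e e' = D + M := by simpa using hsub 1
    rw [hsub, h1, hB, hD] at this
    simpa using this
  -- `D + t • M` with a factor `t` taken out of each of its first two rows; `F 0` has the non-zero
  -- minor of `L A` as determinant.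
  let F : ℂ → Matrix (Fin 2 ⊕ Fin l) (Fin 2 ⊕ Fin l) ℂ := fun t =>
    fromBlocks M.toBlocks₁₁ M.toBlocks₁₂ (t • M.toBlocks₂₁) (1 + t • M.toBlocks₂₂)
  have hF : ∀ t, (D + t • M).det = t ^ 2 * (F t).det := by
    intro t
    have : D + t • M = Matrix.of fun a b => (Sum.elim (fun _ => t) (fun _ => 1) a : ℂ) * F t a b := by
      ext a b
      rcases a with a | a <;> rcases b with b | b <;>
        simp [D, F, toBlocks₁₁, toBlocks₁₂, toBlocks₂₁, toBlocks₂₂]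
    rw [this, det_mul_column]
    simp
  have hFc : Continuous fun t => (F t).det := by
    refine Continuous.matrix_det ?_
    refine Continuous.matrix_fromBlocks ?_ ?_ ?_ ?_ <;> fun_prop
  refine false_of_sq_mul_eq hFc ?_ (r := (D + M).det) (fun t => by rw [← hF, haff])
  simp only [F, zero_smul, add_zero, det_fromBlocks_zero₂₁, det_one, mul_one, det_fin_two]
  simp only [toBlocks₁₁, of_apply, hM, submatrix_apply, he0, he1, he0', he1']
  exact sub_ne_zero.2 hne

end Matrices

/-! ### Schmidt rank as matrix rank; local maps and unitarity. -/

noncomputable section Bridge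

open Matrix

variable {m n : ℕ}

/-- The matrix of coefficients of a bipartite vector in the product basis. -/
def coeffMatrix (m n : ℕ) : Bipartite m n ≃ₗ[ℂ] Matrix (Fin m) (Fin n) ℂ :=
  ((EuclideanSpace.basisFun (Fin m) ℂ).toBasis.tensorProduct
    (EuclideanSpace.basisFun (Fin n) ℂ).toBasis).equivFun ≪≫ₗ
    LinearEquiv.curry ℂ ℂ (Fin m) (Fin n) ≪≫ₗ Matrix.ofLinearEquiv ℂ

theorem coeffMatrix_tmul (a : Hilb m) (b : Hilb n) :
    coeffMatrix m n (a ⊗ₜ b) = vecMulVec a b := by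
  ext i j
  simp [coeffMatrix, vecMulVec_apply, mul_comm]

theorem toLin_coeffMatrix (v : Bipartite m n) :
    Matrix.toLin (EuclideanSpace.basisFun (Fin n) ℂ).toBasis
      (EuclideanSpace.basisFun (Fin m) ℂ).toBasis (coeffMatrix m n v) = vecToOp m n v := by
  induction v using TensorProduct.induction_on with
  | zero => simp
  | add x y hx hy => rw [map_add, map_add, map_add, hx, hy]
  | tmul a b =>
    rw [← LinearEquiv.eq_symm_apply, Matrix.toLin_symm, coeffMatrix_tmul]
    ext i j
    simp [LinearMap.toMatrix_apply, vecToOp_tmul, vecMulVec_apply, mul_comm]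

theorem schmidtRank_eq_rank (v : Bipartite m n) : schmidtRank v = (coeffMatrix m n v).rank := by
  rw [schmidtRank, ← toLin_coeffMatrix, ← Matrix.rank_eq_finrank_range_toLin]

theorem schmidtRank_tmul_le (a : Hilb m) (b : Hilb n) : schmidtRank (a ⊗ₜ[ℂ] b) ≤ 1 := by
  rw [schmidtRank_eq_rank, coeffMatrix_tmul]
  exact rank_vecMulVec_le _ _

theorem schmidtRank_smul_le (c : ℂ) (v : Bipartite m n) : schmidtRank (c • v) ≤ schmidtRank v := by
  rw [schmidtRank_eq_rank, schmidtRank_eq_rank, map_smul]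
  rcases eq_or_ne c 0 with rfl | h
  · simp
  · rw [rank_smul_of_mem_nonZeroDivisors _ (mem_nonZeroDivisors_of_ne_zero h)]

theorem exists_norm_eq_one (hm : 0 < m) : ∃ a : Hilb m, ‖a‖ = 1 :=
  ⟨EuclideanSpace.single ⟨0, hm⟩ 1, by simp⟩

/-- Real multiples suffice because the unit vector carries the phase. The zero vector is `0` times a
product unit vector, which needs `1 ≤ k` and positive dimensions. -/
theorem mem_schmidtSet (hm : 0 < m) (hn : 0 < n) {k : ℕ} (hk : 1 ≤ k) {v : Bipartite m n} :
    v ∈ schmidtSet m n k ↔ schmidtRank v ≤ k := by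
  constructor
  · rintro ⟨c, w, -, hw, rfl⟩
    exact (schmidtRank_smul_le _ _).trans hw
  · intro hv
    rcases eq_or_ne v 0 with rfl | h0
    · obtain ⟨a, ha⟩ := exists_norm_eq_one hm
      obtain ⟨b, hb⟩ := exists_norm_eq_one hn
      exact ⟨0, a ⊗ₜ b, by rw [TensorProduct.norm_tmul, ha, hb, mul_one],
        (schmidtRank_tmul_le a b).trans hk, by simp⟩
    · have hn0 : (‖v‖ : ℂ) ≠ 0 := by simpa using h0
      refine ⟨‖v‖, (‖v‖ : ℂ)⁻¹ • v, ?_, (schmidtRank_smul_le _ _).trans hv, ?_⟩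
      · rw [norm_smul, norm_inv, Complex.norm_real, norm_norm,
          inv_mul_cancel₀ (norm_ne_zero_iff.2 h0)]
      · rw [smul_inv_smul₀ hn0]

/-- A linear map preserving the vectors of Schmidt rank at most `k` preserves product vectors. -/
theorem isPure_of_schmidtRank_preserver {L : Bipartite m n →ₗ[ℂ] Bipartite m n}
    (hL : Function.Surjective L) {k : ℕ} (hk : 1 ≤ k) (hkm : k < m) (hkn : k < n)
    (h : ∀ v, schmidtRank v ≤ k → schmidtRank (L v) ≤ k) (a : Hilb m) (b : Hilb n) :
    IsPure (L (a ⊗ₜ b)) := by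
  let L' : Matrix (Fin m) (Fin n) ℂ →ₗ[ℂ] Matrix (Fin m) (Fin n) ℂ :=
    (coeffMatrix m n).toLinearMap ∘ₗ L ∘ₗ (coeffMatrix m n).symm.toLinearMap
  have hL' : ∀ v, L' (coeffMatrix m n v) = coeffMatrix m n (L v) := fun v => by simp [L']
  obtain ⟨x, y, hxy⟩ := exists_vecMulVec_of_rank_preserver (L := L')
    ((coeffMatrix m n).surjective.comp (hL.comp (coeffMatrix m n).symm.surjective)) hk
    (by simpa using hkm) (by simpa using hkn) (fun X hX => by
      obtain ⟨v, rfl⟩ := (coeffMatrix m n).surjective X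
      rw [hL', ← schmidtRank_eq_rank]
      exact h v (by rwa [schmidtRank_eq_rank]))
    (A := coeffMatrix m n (a ⊗ₜ b))
    (by rw [← schmidtRank_eq_rank]; exact schmidtRank_tmul_le a b)
  refine ⟨WithLp.toLp 2 x, WithLp.toLp 2 y, (coeffMatrix m n).injective ?_⟩
  rw [← hL', hxy, coeffMatrix_tmul]

theorem swap_rfl : swap (rfl : n = n) = (TensorProduct.comm ℂ (Hilb n) (Hilb n)).toLinearMap := by
  ext : 2
  refine LinearMap.ext fun b => ?_
  simp [swap_tmul]

theorem isUnit_of_map_injective {V W : Type*} [AddCommGroup V] [Module ℂ V] [AddCommGroup W]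
    [Module ℂ W] [FiniteDimensional ℂ V] [Nontrivial W] {P : Module.End ℂ V} {Q : Module.End ℂ W}
    (h : Function.Injective (TensorProduct.map P Q)) : IsUnit P := by
  rw [LinearMap.isUnit_iff_ker_eq_bot, LinearMap.ker_eq_bot, injective_iff_map_eq_zero]
  intro a ha
  obtain ⟨b, hb⟩ := exists_ne (0 : W)
  by_contra h0
  exact tmul_ne_zero h0 hb (h (by simp [ha]))

theorem isUnit_of_map_injective_right {V W : Type*} [AddCommGroup V] [Module ℂ V] [AddCommGroup W]
    [Module ℂ W] [FiniteDimensional ℂ W] [Nontrivial V] {P : Module.End ℂ V} {Q : Module.End ℂ W}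
    (h : Function.Injective (TensorProduct.map P Q)) : IsUnit Q := by
  rw [LinearMap.isUnit_iff_ker_eq_bot, LinearMap.ker_eq_bot, injective_iff_map_eq_zero]
  intro b hb
  obtain ⟨a, ha⟩ := exists_ne (0 : V)
  by_contra h0
  exact tmul_ne_zero ha h0 (h (by simp [hb]))

theorem isLocalForm_of_isPure (hm : 2 ≤ m) (hn : 2 ≤ n) {L : Bipartite m n →ₗ[ℂ] Bipartite m n}
    (hL : Function.Injective L) (hp : ∀ (a : Hilb m) (b : Hilb n), IsPure (L (a ⊗ₜ b))) :
    IsLocalForm L := by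
  have : Nontrivial (Hilb m) := Module.nontrivial_of_finrank_pos (R := ℂ) (by simp; omega)
  have : Nontrivial (Hilb n) := Module.nontrivial_of_finrank_pos (R := ℂ) (by simp; omega)
  rcases pure_preserver (by simpa using hm) (by simpa using hn) hL hp with
    ⟨P, Q, rfl⟩ | ⟨hd, P, Q, h⟩
  · exact ⟨P, Q, isUnit_of_map_injective hL, isUnit_of_map_injective_right hL, Or.inl rfl⟩
  · obtain rfl : m = n := by simpa using hd
    have hi : Function.Injective (TensorProduct.map P Q) := by
      rw [h, LinearMap.coe_comp] at hL
      exact hL.of_comp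
    exact ⟨P, Q, isUnit_of_map_injective hi, isUnit_of_map_injective_right hi,
      Or.inr ⟨rfl, by rw [swap_rfl, h]⟩⟩

theorem coeffMatrix_map (P : Module.End ℂ (Hilb m)) (Q : Module.End ℂ (Hilb n))
    (v : Bipartite m n) :
    coeffMatrix m n (TensorProduct.map P Q v) =
      LinearMap.toMatrix (EuclideanSpace.basisFun (Fin m) ℂ).toBasis
        (EuclideanSpace.basisFun (Fin m) ℂ).toBasis P * coeffMatrix m n v *
      (LinearMap.toMatrix (EuclideanSpace.basisFun (Fin n) ℂ).toBasis
        (EuclideanSpace.basisFun (Fin n) ℂ).toBasis Q)ᵀ := by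
  induction v using TensorProduct.induction_on with
  | zero => simp
  | add x y hx hy => rw [map_add, map_add, map_add, hx, hy, Matrix.mul_add, Matrix.add_mul]
  | tmul a b =>
    have hmul : ∀ {d : ℕ} (T : Module.End ℂ (Hilb d)) (x : Hilb d),
        LinearMap.toMatrix (EuclideanSpace.basisFun (Fin d) ℂ).toBasis
          (EuclideanSpace.basisFun (Fin d) ℂ).toBasis T *ᵥ x = T x := fun T x => by
      have := LinearMap.toMatrix_mulVec_repr (EuclideanSpace.basisFun _ ℂ).toBasis
        (EuclideanSpace.basisFun _ ℂ).toBasis T x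
      rwa [show ⇑((EuclideanSpace.basisFun (Fin _) ℂ).toBasis.repr x) = x by ext i; simp,
        show ⇑((EuclideanSpace.basisFun (Fin _) ℂ).toBasis.repr (T x)) = T x by
          ext i; simp] at this
    rw [TensorProduct.map_tmul, coeffMatrix_tmul, coeffMatrix_tmul, mul_vecMulVec, vecMulVec_mul,
      vecMul_transpose, hmul, hmul]

theorem schmidtRank_map {P : Module.End ℂ (Hilb m)} {Q : Module.End ℂ (Hilb n)}
    (hP : IsUnit P) (hQ : IsUnit Q) (v : Bipartite m n) :
    schmidtRank (TensorProduct.map P Q v) = schmidtRank v := by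
  rw [schmidtRank_eq_rank, schmidtRank_eq_rank, coeffMatrix_map, rank_mul_eq_left_of_isUnit_det,
    rank_mul_eq_right_of_isUnit_det]
  · rw [LinearMap.det_toMatrix]
    exact hP.map LinearMap.det
  · rw [det_transpose, LinearMap.det_toMatrix]
    exact hQ.map LinearMap.det

theorem schmidtRank_swap (v : Bipartite n n) : schmidtRank (swap rfl v) = schmidtRank v := by
  have h : coeffMatrix n n (swap rfl v) = (coeffMatrix n n v)ᵀ := by
    induction v using TensorProduct.induction_on with
    | zero => simp
    | add x y hx hy => rw [map_add, map_add, map_add, hx, hy, transpose_add]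
    | tmul a b => rw [swap_tmul, coeffMatrix_tmul, coeffMatrix_tmul, transpose_vecMulVec]
  rw [schmidtRank_eq_rank, schmidtRank_eq_rank, h, rank_transpose]

theorem IsLocalForm.schmidtRank_eq {L : Module.End ℂ (Bipartite m n)} (h : IsLocalForm L)
    (v : Bipartite m n) : schmidtRank (L v) = schmidtRank v := by
  obtain ⟨P, Q, hP, hQ, rfl | ⟨rfl, rfl⟩⟩ := h
  · exact schmidtRank_map hP hQ v
  · rw [LinearMap.comp_apply, schmidtRank_swap, schmidtRank_map hP hQ]

theorem mem_unitary_of_norm_map {E : Type*} [NormedAddCommGroup E] [InnerProductSpace ℂ E]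
    [FiniteDimensional ℂ E] {T : E →ₗ[ℂ] E} (h : ∀ x, ‖T x‖ = ‖x‖) : T ∈ unitary (E →ₗ[ℂ] E) := by
  have h1 : star T * T = 1 := by
    ext x
    refine ext_inner_left ℂ fun y => ?_
    rw [Module.End.mul_apply, LinearMap.star_eq_adjoint, LinearMap.adjoint_inner_right]
    exact (⟨T, h⟩ : E →ₗᵢ[ℂ] E).inner_map_map y x
  exact Unitary.mem_iff.2 ⟨h1, mul_eq_one_comm.1 h1⟩

theorem norm_swap (v : Bipartite n n) : ‖swap rfl v‖ = ‖v‖ := by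
  rw [swap_rfl]
  exact TensorProduct.norm_comm v

/-- If `P ⊗ Q` preserves the norm of product vectors, then it is a tensor product of unitaries. -/
theorem exists_unitary_map (hm : 0 < m) (hn : 0 < n) {P : Module.End ℂ (Hilb m)}
    {Q : Module.End ℂ (Hilb n)} (h : ∀ a b, ‖P a‖ * ‖Q b‖ = ‖a‖ * ‖b‖) :
    (∀ v, ‖TensorProduct.map P Q v‖ = ‖v‖) ∧
      ∃ (W : Hilb m →ₗ[ℂ] Hilb m) (Y : Hilb n →ₗ[ℂ] Hilb n),
        W ∈ unitary (Hilb m →ₗ[ℂ] Hilb m) ∧ Y ∈ unitary (Hilb n →ₗ[ℂ] Hilb n) ∧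
        TensorProduct.map P Q = TensorProduct.map W Y := by
  obtain ⟨a₀, ha₀⟩ := exists_norm_eq_one hm
  obtain ⟨b₀, hb₀⟩ := exists_norm_eq_one hn
  have hc : ‖P a₀‖ * ‖Q b₀‖ = 1 := by rw [h, ha₀, hb₀, mul_one]
  -- Since `‖P a₀‖ = c⁻¹`, both `c • P` and `c⁻¹ • Q` are isometries, and the scalars cancel in the
  -- tensor product.
  set c := ‖Q b₀‖ with hcdef
  have hc0 : c ≠ 0 := right_ne_zero_of_mul_eq_one hc
  have hcC : (c : ℂ) ≠ 0 := by exact_mod_cast hc0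
  have hW : ∀ a, ‖((c : ℂ) • P) a‖ = ‖a‖ := fun a => by
    rw [LinearMap.smul_apply, norm_smul, Complex.norm_real, hcdef, norm_norm, mul_comm, h, hb₀,
      mul_one]
  have hY : ∀ b, ‖((c : ℂ)⁻¹ • Q) b‖ = ‖b‖ := fun b => by
    rw [LinearMap.smul_apply, norm_smul, norm_inv, Complex.norm_real, hcdef, norm_norm, ← hcdef,
      ← eq_inv_of_mul_eq_one_left hc, h, ha₀, one_mul]
  have hmap : TensorProduct.map P Q = TensorProduct.map ((c : ℂ) • P) ((c : ℂ)⁻¹ • Q) := by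
    rw [TensorProduct.map_smul_left, TensorProduct.map_smul_right, smul_inv_smul₀ hcC]
  refine ⟨fun v => ?_, _, _, mem_unitary_of_norm_map hW, mem_unitary_of_norm_map hY, hmap⟩
  rw [hmap]
  exact TensorProduct.norm_map (⟨_, hW⟩ : Hilb m →ₗᵢ[ℂ] Hilb m) (⟨_, hY⟩ : Hilb n →ₗᵢ[ℂ] Hilb n) v

theorem IsLocalForm.unitary (hm : 0 < m) (hn : 0 < n) {L : Module.End ℂ (Bipartite m n)}
    (hL : IsLocalForm L) (h : ∀ (a : Hilb m) (b : Hilb n), ‖L (a ⊗ₜ b)‖ = ‖a‖ * ‖b‖) :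
    L ∈ unitary (Bipartite m n →ₗ[ℂ] Bipartite m n) ∧ IsLocalUnitaryForm L := by
  obtain ⟨P, Q, -, -, rfl | ⟨rfl, rfl⟩⟩ := hL
  · obtain ⟨hnorm, W, Y, hW, hY, hWY⟩ := exists_unitary_map hm hn (P := P) (Q := Q) (fun a b => by
      rw [← TensorProduct.norm_tmul (𝕜 := ℂ), ← TensorProduct.map_tmul, h])
    exact ⟨mem_unitary_of_norm_map hnorm, W, Y, hW, hY, Or.inl hWY⟩
  · obtain ⟨hnorm, W, Y, hW, hY, hWY⟩ := exists_unitary_map hm hn (P := P) (Q := Q) (fun a b => by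
      rw [← TensorProduct.norm_tmul (𝕜 := ℂ), ← TensorProduct.map_tmul, ← norm_swap,
        ← LinearMap.comp_apply, h])
    refine ⟨mem_unitary_of_norm_map fun v => ?_, W, Y, hW, hY, Or.inr ⟨rfl, by rw [hWY]⟩⟩
    rw [LinearMap.comp_apply, norm_swap, hnorm]

theorem norm_map_of_norm_one {E F : Type*} [NormedAddCommGroup E] [NormedSpace ℂ E]
    [NormedAddCommGroup F] [NormedSpace ℂ F] (L : E →ₗ[ℂ] F) {v : E}
    (h : v ≠ 0 → ‖L ((‖v‖ : ℂ)⁻¹ • v)‖ = 1) : ‖L v‖ = ‖v‖ := by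
  rcases eq_or_ne v 0 with rfl | h0
  · simp
  have hn := norm_ne_zero_iff.2 h0
  have := h h0
  rw [map_smul, norm_smul, norm_inv, Complex.norm_real, norm_norm, inv_mul_eq_iff_eq_mul₀ hn,
    mul_one] at this
  exact this

end Bridge

end SchmidtPreserver

open SchmidtPreserver in
theorem theorem4p1 (m n : ℕ) (hmn : 2 ≤ min m n)
    (L : Bipartite m n →ₗ[ℂ] Bipartite m n) (hL : IsUnit L) :
    List.TFAE [
      ∃ k, 1 ≤ k ∧ k < min m n ∧ L '' schmidtSet m n k ⊆ schmidtSet m n k,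
      ∀ k, 1 ≤ k → k ≤ min m n → L '' schmidtSet m n k = schmidtSet m n k,
      IsLocalForm L] ∧
    ((∃ k, 1 ≤ k ∧ k < min m n ∧ L '' schmidtSet m n k ⊆ schmidtSet m n k) →
      ∀ k, 1 ≤ k → k ≤ min m n →
        (∀ v ∈ schmidtSet m n k, ‖v‖ = 1 → ‖L v‖ = 1) →
        L ∈ unitary (Bipartite m n →ₗ[ℂ] Bipartite m n) ∧ IsLocalUnitaryForm L) := by
  obtain ⟨hm, hn⟩ := le_min_iff.1 hmn
  have hm0 : 0 < m := by omega
  have hn0 : 0 < n := by omega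
  have hbij : Function.Bijective L := (Module.End.isUnit_iff L).1 hL
  have hac : (∃ k, 1 ≤ k ∧ k < min m n ∧ L '' schmidtSet m n k ⊆ schmidtSet m n k) →
      IsLocalForm L := by
    rintro ⟨k, hk, hkmn, hsub⟩
    obtain ⟨hkm, hkn⟩ := lt_min_iff.1 hkmn
    refine isLocalForm_of_isPure hm hn hbij.1
      (isPure_of_schmidtRank_preserver hbij.2 hk hkm hkn fun v hv => ?_)
    rw [← mem_schmidtSet hm0 hn0 hk] at hv ⊢
    exact hsub ⟨v, hv, rfl⟩
  refine ⟨?_, fun ha k hk _ hnorm => (hac ha).unitary hm0 hn0 fun a b => ?_⟩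
  · tfae_have 1 → 3 := hac
    tfae_have 3 → 2 := by
      intro h k hk _
      ext v
      constructor
      · rintro ⟨w, hw, rfl⟩
        rw [mem_schmidtSet hm0 hn0 hk] at hw ⊢
        rwa [h.schmidtRank_eq]
      · intro hv
        obtain ⟨w, rfl⟩ := hbij.2 v
        refine ⟨w, ?_, rfl⟩
        rw [mem_schmidtSet hm0 hn0 hk] at hv ⊢
        rwa [h.schmidtRank_eq] at hv
    tfae_have 2 → 1 := fun h => ⟨1, le_rfl, by omega, (h 1 le_rfl (by omega)).subset⟩
    tfae_finish
  -- Product vectors have Schmidt rank at most `1 ≤ k`, so the norm hypothesis covers them for every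
  -- `k`.
  · rw [← TensorProduct.norm_tmul (𝕜 := ℂ)]
    refine norm_map_of_norm_one L fun h0 => hnorm _ ?_ ?_
    · rw [mem_schmidtSet hm0 hn0 hk]
      exact (schmidtRank_smul_le _ _).trans ((schmidtRank_tmul_le a b).trans hk)
    · rw [norm_smul, norm_inv, Complex.norm_real, norm_norm,
        inv_mul_cancel₀ (norm_ne_zero_iff.2 h0)]
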